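/- All graphs are finite, undirected and simple. A path decomposition of a graph $G$ is a collection of pairwise edge-disjoint paths of $G$ that covers all the edges of $G$; $p(G)$ denotes the minimum number of paths in a path decomposition of $G$, and $n_o(G)$ the number of vertices of odd degree in $G$. The Cartesian product $G\Box H$ is the graph on $V(G)\times V(H)$ in which $(u_1,v_1)$ and $(u_2,v_2)$ are adjacent if and only if either $u_1u_2\in E(G)$ and $v_1=v_2$, or $v_1v_2\in E(H)$ and $u_1=u_2$. Theorem 4.2. Let $G$ be a connected graph of order $m\ge 2$ and let $H$ be a connected graph of order $n$. If $p(G)=\frac{n_o(G)}{2}$, then $p(G\Box H)\le \frac{mn}{2}$. In particular, $G\Box H$ is a connected graph of order $mn$ with $p(G\Box H)\le\lceil\frac{mn}{2}\rceil$, that is, Gallai's conjecture (every connected graph of order $N$ can be decomposed into at most $\lceil\frac{N}{2}\rceil$ paths) holds for $G\Box H$. -/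

import Mathlib

namespace SimpleGraph

variable {V : Type*}

/-- A subgraph `S` of `G` is a path if it consists of the vertices and edges of a walk in `G`
that repeats no vertex. (One-vertex paths are allowed; they never affect the minimum number of
paths in a path decomposition.) -/
def Subgraph.IsPathSubgraph {G : SimpleGraph V} (S : G.Subgraph) : Prop :=
  ∃ (u v : V) (w : G.Walk u v), w.IsPath ∧ w.toSubgraph = S

/-- A path decomposition of `G`: a finite collection of pairwise edge-disjoint paths of `G` that
covers all the edges of `G`. -/
structure IsPathDecomposition (G : SimpleGraph V) (P : Finset G.Subgraph) : Prop where
  isPath : ∀ S ∈ P, S.IsPathSubgraph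
  edgeDisjoint : ∀ S ∈ P, ∀ T ∈ P, S ≠ T → Disjoint S.edgeSet T.edgeSet
  cover : ∀ e ∈ G.edgeSet, ∃ S ∈ P, e ∈ S.edgeSet

/-- `p(G)`, the minimum number of paths in a path decomposition of `G`. For finite `G` the
minimum is attained, see `exists_isPathDecomposition_card_eq_pathNumber`. -/
noncomputable def pathNumber (G : SimpleGraph V) : ℕ :=
  sInf {k : ℕ | ∃ P : Finset G.Subgraph, G.IsPathDecomposition P ∧ P.card = k}

/-- `n_o(G)`, the number of vertices of odd degree in `G`. -/
def oddVertexCount (G : SimpleGraph V) [Fintype V] [DecidableRel G.Adj] : ℕ :=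
  (Finset.univ.filter fun v : V => Odd (G.degree v)).card

/-- A finite graph has a path decomposition: its single edges. -/
theorem exists_isPathDecomposition [Finite V] (G : SimpleGraph V) :
    ∃ P : Finset G.Subgraph, G.IsPathDecomposition P := by
  classical
  have hfin : {S : G.Subgraph | ∃ (u v : V) (h : G.Adj u v), G.subgraphOfAdj h = S}.Finite :=
    Set.toFinite _
  refine ⟨hfin.toFinset, ?_, ?_, ?_⟩
  · intro S hS
    obtain ⟨u, v, h, rfl⟩ := hfin.mem_toFinset.1 hS
    exact ⟨u, v, Walk.cons h Walk.nil, by simp [h.ne],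
      Walk.toSubgraph_cons_nil_eq_subgraphOfAdj h⟩
  · intro S hS T hT hne
    obtain ⟨u, v, h, rfl⟩ := hfin.mem_toFinset.1 hS
    obtain ⟨a, b, h', rfl⟩ := hfin.mem_toFinset.1 hT
    rw [Set.disjoint_left]
    intro e he he'
    rw [edgeSet_subgraphOfAdj, Set.mem_singleton_iff] at he he'
    apply hne
    have hs : s(u, v) = s(a, b) := he.symm.trans he'
    rcases Sym2.eq_iff.1 hs with ⟨rfl, rfl⟩ | ⟨rfl, rfl⟩
    · rfl
    · exact (subgraphOfAdj_symm h').symm ▸ rfl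
  · intro e he
    induction e with
    | _ u v =>
      have h : G.Adj u v := he
      exact ⟨G.subgraphOfAdj h, hfin.mem_toFinset.2 ⟨u, v, h, rfl⟩, by simp⟩

/-- The minimum defining `pathNumber` is attained for finite graphs. -/
theorem exists_isPathDecomposition_card_eq_pathNumber [Finite V] (G : SimpleGraph V) :
    ∃ P : Finset G.Subgraph, G.IsPathDecomposition P ∧ P.card = G.pathNumber := by
  obtain ⟨P, hP⟩ := G.exists_isPathDecomposition
  exact Nat.sInf_mem (s := {k : ℕ | ∃ P : Finset G.Subgraph,
    G.IsPathDecomposition P ∧ P.card = k}) ⟨P.card, P, hP, rfl⟩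

end SimpleGraph

/-!
As `2 * p(G) = n_o(G)`, an optimal path decomposition of `G` has every odd vertex as an end exactly
once and no other ends. Cutting it at the even vertices, at the cost of one path for each, makes
every even vertex an end exactly twice. In each copy of `G` in the product, the ends of these paths
can then be continued into the copies of `H`, once at odd and twice at even vertices of `G`.

Following Lovász, a graph all of whose vertices but at most one per component have odd degree
decomposes into paths ending exactly once at each odd vertex. Such a decomposition is built edge by
edge. To add the edge `bx`, prolong to `b` a path ending at `x` that avoids `b`. If instead `x` is
an end of a path through `b`, reverse the part of this path between `b` and `x`: this uses the edge
`bx` and frees the edge from `b` to another vertex, which is then attached in the same way.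

Removing paths between even vertices of `H` as long as possible leaves a graph of this kind, so
`H` is the union of a path system `Q` with distinct ends, hence of size at most `|H| / 2`, and a
system `J` of removed paths whose ends are distinct ends of `Q`. By Hall's theorem the members of
`Q` and `J` together start at distinct vertices, so the copies of `H` at odd vertices of `G` are
used up by continuations. Again by Hall, each member of `J` shares an end with its own member of
`Q`. At an even vertex of `G` these pairs are used up by continuations, and a layer in which no pair
starts needs no cut; so the cuts and the unpaired members of `Q` add only `|Q|` paths for each even
vertex of `G`.
-/

namespace PathSystem

open Multiset

variable {V W : Type*}

section Lists

/-- The first vertex of a path given as a list of vertices, as a multiset of cardinality at most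
one, so that sums over families of paths need no case distinction for the empty list. -/
def first : List V → Multiset V
  | [] => 0
  | a :: _ => {a}

/-- The edges of the path given by a list of vertices: the pairs of consecutive vertices. -/
def pathEdges : List V → Multiset (Sym2 V)
  | [] => 0
  | a :: l => (first l).map (fun c => s(a, c)) + pathEdges l

/-- The two ends of the path given by a list of vertices; a one-vertex path has its vertex as an
end twice. -/
def pathEnds (l : List V) : Multiset V := first l + first l.reverse

/-- The end other than `b` of the path `b :: l`, except that it is `b` if `l` is empty. -/
def farEnd (b : V) (l : List V) : Multiset V := first (b :: l).reverse

/-- Two lists describe the same undirected path if they agree up to reversal. -/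
def SamePath (l l' : List V) : Prop := l' = l ∨ l' = l.reverse

variable {l l' : List V} {a b v : V}

@[simp] theorem first_nil : first ([] : List V) = 0 := rfl

@[simp] theorem first_cons (a : V) (l : List V) : first (a :: l) = {a} := rfl

@[simp] theorem pathEdges_nil : pathEdges ([] : List V) = 0 := rfl

theorem pathEdges_cons (a : V) (l : List V) :
    pathEdges (a :: l) = (first l).map (fun c => s(a, c)) + pathEdges l := rfl

@[simp] theorem pathEdges_singleton (a : V) : pathEdges [a] = 0 := rfl

theorem pathEdges_cons_cons (a c : V) (l : List V) :
    pathEdges (a :: c :: l) = s(a, c) ::ₘ pathEdges (c :: l) := rfl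

theorem pathEnds_cons (b : V) (l : List V) : pathEnds (b :: l) = {b} + farEnd b l := rfl

theorem first_append (h : l ≠ []) (l' : List V) : first (l ++ l') = first l := by
  cases l with
  | nil => exact absurd rfl h
  | cons a l => rfl

theorem mem_first : a ∈ first l ↔ first l = {a} := by
  cases l <;> simp [eq_comm]

theorem exists_first_eq (h : l ≠ []) : ∃ a, first l = {a} := by
  cases l with
  | nil => exact absurd rfl h
  | cons a l => exact ⟨a, rfl⟩

theorem mem_of_mem_first (h : a ∈ first l) : a ∈ l := by
  cases l <;> simp_all

theorem exists_cons_of_first_eq (h : first l = {a}) : ∃ t, l = a :: t := by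
  cases l with
  | nil => simp at h
  | cons c t => exact ⟨t, by rw [singleton_inj.1 h]⟩

theorem mem_of_mem_pathEdges {e : Sym2 V} (he : e ∈ pathEdges l) (hv : v ∈ e) : v ∈ l := by
  induction l with
  | nil => simp at he
  | cons a l ih =>
    rcases Multiset.mem_add.1 he with he | he
    · obtain ⟨c, hc, rfl⟩ := mem_map.1 he
      rcases Sym2.mem_iff.1 hv with rfl | rfl
      · exact List.mem_cons_self
      · exact List.mem_cons_of_mem _ (mem_of_mem_first hc)
    · exact List.mem_cons_of_mem _ (ih he)

theorem pathEdges_append_cons (l : List V) (a : V) (l' : List V) :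
    pathEdges (l ++ a :: l') = pathEdges (l ++ [a]) + pathEdges (a :: l') := by
  induction l with
  | nil => simp
  | cons c l ih =>
    have hfirst : first (l ++ a :: l') = first (l ++ [a]) := by cases l <;> rfl
    rw [List.cons_append, List.cons_append, pathEdges_cons, pathEdges_cons c (l ++ [a]), ih,
      hfirst, add_assoc]

theorem pathEdges_concat (l : List V) (a : V) :
    pathEdges (l ++ [a]) = pathEdges l + (first l.reverse).map (fun c => s(c, a)) := by
  rcases List.eq_nil_or_concat l with rfl | ⟨l', c, rfl⟩
  · rfl
  · rw [List.concat_eq_append, List.append_assoc, List.singleton_append, pathEdges_append_cons,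
      List.reverse_concat']
    rfl

@[simp] theorem pathEdges_reverse (l : List V) : pathEdges l.reverse = pathEdges l := by
  induction l with
  | nil => rfl
  | cons a l ih =>
    rw [List.reverse_cons, pathEdges_concat, ih, List.reverse_reverse, pathEdges_cons, add_comm]
    simp only [Sym2.eq_swap]

@[simp] theorem pathEnds_reverse (l : List V) : pathEnds l.reverse = pathEnds l := by
  rw [pathEnds, pathEnds, List.reverse_reverse, add_comm]

theorem card_pathEnds (h : l ≠ []) : card (pathEnds l) = 2 := by
  obtain ⟨a, ha⟩ := exists_first_eq h
  obtain ⟨z, hz⟩ := exists_first_eq (List.reverse_ne_nil_iff.2 h)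
  rw [pathEnds, card_add, ha, hz, card_singleton, card_singleton]

theorem farEnd_eq (b : V) (h : l ≠ []) : farEnd b l = first l.reverse := by
  rw [farEnd, List.reverse_cons, first_append (List.reverse_ne_nil_iff.2 h)]

theorem farEnd_add_first (b : V) (h : l ≠ []) : farEnd b l + first l = pathEnds l := by
  rw [farEnd_eq b h, add_comm, pathEnds]

theorem even_count_pathEnds_add [DecidableEq V] (hl : l.Nodup) (v : V) :
    Even (count v (pathEnds l) + countP (v ∈ ·) (pathEdges l)) := by
  induction l with
  | nil => simp [pathEnds]
  | cons a l ih =>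
    obtain ⟨hal, hl⟩ := List.nodup_cons.1 hl
    cases l with
    | nil => exact ⟨count v {a}, count_add v {a} {a}⟩
    | cons c l =>
      have hac : a ≠ c := fun h => hal (h ▸ List.mem_cons_self)
      have hfar : farEnd a (c :: l) = farEnd c l := farEnd_eq a (List.cons_ne_nil c l)
      have ih := ih hl
      rw [pathEnds_cons, count_add, count_singleton] at ih
      rw [pathEnds_cons, hfar, pathEdges_cons_cons, count_add, count_singleton, countP_cons]
      simp only [Sym2.mem_iff]
      grind

namespace SamePath

theorem pathEdges_eq (h : SamePath l l') : pathEdges l' = pathEdges l := by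
  rcases h with rfl | rfl
  exacts [rfl, pathEdges_reverse l]

theorem pathEnds_eq (h : SamePath l l') : pathEnds l' = pathEnds l := by
  rcases h with rfl | rfl
  exacts [rfl, pathEnds_reverse l]

theorem perm (h : SamePath l l') : l'.Perm l := by
  rcases h with rfl | rfl
  exacts [List.Perm.refl _, List.reverse_perm _]

theorem farEnd_add_first_eq (h : SamePath l l') (b : V) :
    farEnd b l' + first l' = farEnd b l + first l := by
  rcases eq_or_ne l [] with rfl | hl
  · rcases h with rfl | rfl <;> rfl
  · have hl' : l' ≠ [] := by rcases h with rfl | rfl <;> simpa using hl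
    rw [farEnd_add_first b hl, farEnd_add_first b hl', h.pathEnds_eq]

end SamePath

theorem exists_samePath_first_eq (h : a ∈ pathEnds l) : ∃ l', SamePath l l' ∧ first l' = {a} := by
  rcases Multiset.mem_add.1 h with h | h
  exacts [⟨l, .inl rfl, mem_first.1 h⟩, ⟨l.reverse, .inr rfl, mem_first.1 h⟩]

theorem exists_samePath_cons (h : a ∈ pathEnds l) : ∃ t, SamePath l (a :: t) := by
  obtain ⟨l', hl', hfirst⟩ := exists_samePath_first_eq h
  obtain ⟨t, rfl⟩ := exists_cons_of_first_eq hfirst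
  exact ⟨t, hl'⟩

theorem exists_samePath_cons_concat {z : V} (h : pathEnds l = {a, z}) (haz : a ≠ z) :
    ∃ m, SamePath l (a :: (m ++ [z])) := by
  obtain ⟨t, ht⟩ := exists_samePath_cons (l := l) (a := a) (by simp [h])
  have hfar : farEnd a t = {z} := by
    have hends := ht.pathEnds_eq.trans h
    rwa [pathEnds_cons, insert_eq_cons, ← Multiset.singleton_add, add_right_inj] at hends
  rcases List.eq_nil_or_concat t with rfl | ⟨m, c, rfl⟩
  · exact absurd (singleton_inj.1 hfar) haz
  · rw [List.concat_eq_append] at ht hfar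
    rw [farEnd_eq a (by simp), List.reverse_concat'] at hfar
    exact ⟨m, singleton_inj.1 hfar ▸ ht⟩

end Lists

section Arms

/-- The path through `b` whose two arms, read starting from `b`, are `arm false` and `arm true`. -/
def through (b : V) (arm : Bool → List V) : List V := (arm false).reverse ++ b :: arm true

variable {b : V} {l : List V}

theorem exists_eq_through (h : b ∈ l) : ∃ arm, l = through b arm := by
  obtain ⟨A, B, rfl⟩ := List.append_of_mem h
  exact ⟨fun c => bif c then B else A.reverse, by simp [through]⟩

theorem pathEdges_through (b : V) (arm : Bool → List V) :
    pathEdges (through b arm) = ∑ c, pathEdges (b :: arm c) := by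
  rw [through, pathEdges_append_cons, ← List.reverse_cons, pathEdges_reverse, Fintype.sum_bool,
    add_comm]

theorem pathEnds_through (b : V) (arm : Bool → List V) :
    pathEnds (through b arm) = ∑ c, farEnd b (arm c) := by
  have hfirst : first (through b arm) = farEnd b (arm false) := by
    rw [through, farEnd, List.reverse_cons]
    cases (arm false).reverse <;> rfl
  have hlast : first (through b arm).reverse = farEnd b (arm true) := by
    rw [through, List.reverse_append, first_append (by simp), farEnd]
  rw [pathEnds, hfirst, hlast, Fintype.sum_bool, add_comm]

theorem through_perm {arm arm' : Bool → List V} (h : ∀ c, (arm' c).Perm (arm c)) :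
    (through b arm').Perm (through b arm) :=
  (((List.reverse_perm _).trans (h false)).trans (List.reverse_perm _).symm).append
    ((h true).cons b)

theorem nodup_cons_of_nodup_through {arm : Bool → List V} (h : (through b arm).Nodup) (c : Bool) :
    (b :: arm c).Nodup := by
  obtain ⟨hfalse, htrue, hdisj⟩ := List.nodup_append'.1 h
  cases c
  · refine List.nodup_cons.2 ⟨fun hb => ?_, List.nodup_reverse.1 hfalse⟩
    exact hdisj (List.mem_reverse.2 hb) List.mem_cons_self
  · exact htrue

end Arms

section Systems

variable {M M' : Multiset (List V)} {E E' : Multiset (Sym2 V)} {D D' : Multiset V}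

/-- A path system with edges `E` and ends `D`: a multiset of paths, given as lists of vertices,
whose edges and whose ends, counted with multiplicity, are `E` and `D`. -/
structure IsPathSystem (M : Multiset (List V)) (E : Multiset (Sym2 V)) (D : Multiset V) :
    Prop where
  ne_nil : ∀ l ∈ M, l ≠ []
  nodup : ∀ l ∈ M, l.Nodup
  edges : M.bind pathEdges = E
  ends : M.bind pathEnds = D

namespace IsPathSystem

theorem card_ends (h : IsPathSystem M E D) : card D = 2 * card M := by
  have hcard : M.map (card ∘ pathEnds) = M.map fun _ => 2 :=
    map_congr rfl fun l hl => card_pathEnds (h.ne_nil l hl)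
  rw [← h.ends, card_bind, hcard, map_const', sum_replicate, smul_eq_mul, mul_comm]

theorem of_le (h : IsPathSystem M E D) (hM : M' ≤ M) :
    IsPathSystem M' (M'.bind pathEdges) (M'.bind pathEnds) where
  ne_nil l hl := h.ne_nil l (mem_of_le hM hl)
  nodup l hl := h.nodup l (mem_of_le hM hl)
  edges := rfl
  ends := rfl

theorem zero : IsPathSystem (0 : Multiset (List V)) 0 0 where
  ne_nil l hl := absurd hl (notMem_zero l)
  nodup l hl := absurd hl (notMem_zero l)
  edges := zero_bind _
  ends := zero_bind _

theorem singleton {l : List V} (h : l ≠ []) (h' : l.Nodup) :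
    IsPathSystem {l} (pathEdges l) (pathEnds l) where
  ne_nil _ hl := mem_singleton.1 hl ▸ h
  nodup _ hl := mem_singleton.1 hl ▸ h'
  edges := singleton_bind _ _
  ends := singleton_bind _ _

theorem singletons (C : Multiset V) : IsPathSystem (C.map fun v => [v]) 0 (2 • C) where
  ne_nil l hl := by
    obtain ⟨v, -, rfl⟩ := mem_map.1 hl
    exact List.cons_ne_nil v []
  nodup l hl := by
    obtain ⟨v, -, rfl⟩ := mem_map.1 hl
    exact List.nodup_singleton v
  edges := by simp only [bind_map, pathEdges_singleton, bind_zero]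
  ends := by
    have hends (v : V) : pathEnds [v] = {v} + {v} := rfl
    rw [bind_map, bind_congr fun v _ => hends v, bind_add, two_nsmul]
    exact congrArg₂ _ (sum_map_singleton C) (sum_map_singleton C)

theorem add (h : IsPathSystem M E D) (h' : IsPathSystem M' E' D') :
    IsPathSystem (M + M') (E + E') (D + D') where
  ne_nil l hl := (Multiset.mem_add.1 hl).elim (h.ne_nil l) (h'.ne_nil l)
  nodup l hl := (Multiset.mem_add.1 hl).elim (h.nodup l) (h'.nodup l)
  edges := by rw [add_bind, h.edges, h'.edges]
  ends := by rw [add_bind, h.ends, h'.ends]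

theorem cons {l : List V} (hne : l ≠ []) (hl : l.Nodup) (h : IsPathSystem M E D) :
    IsPathSystem (l ::ₘ M) (pathEdges l + E) (pathEnds l + D) :=
  (singleton hne hl).add h

theorem sum {ι : Type*} {s : Finset ι} {M : ι → Multiset (List V)} {E : ι → Multiset (Sym2 V)}
    {D : ι → Multiset V} (h : ∀ i ∈ s, IsPathSystem (M i) (E i) (D i)) :
    IsPathSystem (∑ i ∈ s, M i) (∑ i ∈ s, E i) (∑ i ∈ s, D i) := by
  classical
  induction s using Finset.induction_on with
  | empty => exact zero
  | insert i s hi ih =>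
    rw [Finset.sum_insert hi, Finset.sum_insert hi, Finset.sum_insert hi]
    exact (h i (Finset.mem_insert_self i s)).add
      (ih fun j hj => h j (Finset.mem_insert_of_mem hj))

theorem even_count_add [DecidableEq V] (h : IsPathSystem M E D) (v : V) :
    Even (count v D + countP (v ∈ ·) E) := by
  obtain ⟨-, hnodup, rfl, rfl⟩ := h
  induction M using Multiset.induction_on with
  | empty => simp
  | cons l M ih =>
    have hM := ih fun l' hl' => hnodup l' (mem_cons_of_mem hl')
    have hl := even_count_pathEnds_add (hnodup l (mem_cons_self l M)) v
    rw [cons_bind, cons_bind, count_add, countP_add, add_add_add_comm]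
    exact hl.add hM

end IsPathSystem

end Systems

section AddEdge

variable {ι : Type*}

theorem exists_reversed_arms (arm : ι → List V) (R : Multiset (List V)) (s : Finset ι) (x : V)
    (hnodup : (x ::ₘ ∑ i ∈ s, first (arm i)).Nodup)
    (hend : ∀ u ∈ x ::ₘ ∑ i ∈ s, first (arm i),
      (∃ r ∈ R, u ∈ pathEnds r) ∨ ∃ i ∈ s, u ∈ first (arm i).reverse) :
    ∃ arm' : ι → List V, (∀ i, SamePath (arm i) (arm' i)) ∧ ∃ r ∈ R, ∃ r', SamePath r r' ∧
      ∑ i ∈ s, first (arm' i) + first r' = ∑ i ∈ s, first (arm i) + {x} := by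
  classical
  induction s using Finset.strongInduction generalizing x with
  | H s ih =>
    rcases hend x (mem_cons_self x _) with ⟨r, hr, hx⟩ | ⟨i, hi, hx⟩
    · obtain ⟨r', hr', hfirst⟩ := exists_samePath_first_eq hx
      exact ⟨arm, fun i => .inl rfl, r, hr, r', hr', by rw [hfirst]⟩
    -- Reverse the arm that ends in `x`; its former first vertex then has to be attached anew.
    have hlast := mem_first.1 hx
    obtain ⟨y, hy⟩ : ∃ y, first (arm i) = {y} :=
      exists_first_eq fun h => by rw [h] at hlast; exact absurd hlast.symm (singleton_ne_zero x)
    have hsum : ∑ j ∈ s, first (arm j) = y ::ₘ ∑ j ∈ s.erase i, first (arm j) := by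
      rw [← Finset.add_sum_erase s _ hi, hy, Multiset.singleton_add]
    rw [hsum] at hnodup hend
    obtain ⟨hx', hnodup⟩ := Multiset.nodup_cons.1 hnodup
    obtain ⟨arm', harm', r, hr, r', hr', heq⟩ := ih (s.erase i) (Finset.erase_ssubset hi) y hnodup
      fun u hu => (hend u (mem_cons_of_mem hu)).imp_right fun ⟨j, hj, huj⟩ => by
        refine ⟨j, Finset.mem_erase.2 ⟨?_, hj⟩, huj⟩
        rintro rfl
        rw [hlast, mem_singleton] at huj
        exact hx' (huj ▸ hu)
    refine ⟨Function.update arm' i (arm i).reverse, fun j => ?_, r, hr, r', hr', ?_⟩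
    · rcases eq_or_ne j i with rfl | hj
      · rw [Function.update_self]
        exact .inr rfl
      · rw [Function.update_of_ne hj]
        exact harm' j
    · have hrest : ∑ j ∈ s.erase i, first (Function.update arm' i (arm i).reverse j) =
          ∑ j ∈ s.erase i, first (arm' j) :=
        Finset.sum_congr rfl fun j hj => by rw [Function.update_of_ne (Finset.ne_of_mem_erase hj)]
      rw [← Finset.add_sum_erase s _ hi, hrest, Function.update_self, hlast, add_assoc, heq, hsum,
        ← Multiset.singleton_add]
      abel

variable [Fintype ι]

/-- The paths through `b` with arms `arm (i, false)` and `arm (i, true)`. -/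
def star (b : V) (arm : ι × Bool → List V) : Multiset (List V) :=
  (Finset.univ : Finset ι).val.map fun i => through b fun c => arm (i, c)

variable {b x : V} {arm arm' : ι × Bool → List V} {r r' : List V} {M R : Multiset (List V)}
  {E : Multiset (Sym2 V)} {D : Multiset V}

theorem mem_star {l : List V} : l ∈ star b arm ↔ ∃ i, through b (fun c => arm (i, c)) = l := by
  simp [star]

theorem bind_star {α : Type*} (f : List V → Multiset α) (g : List V → Multiset α)
    (h : ∀ a : Bool → List V, f (through b a) = ∑ c, g (a c)) (arm : ι × Bool → List V) :
    (star b arm).bind f = ∑ p, g (arm p) := by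
  rw [Fintype.sum_prod_type, star, bind_map]
  exact Finset.sum_congr rfl fun i _ => h _

theorem bind_pathEnds_star : (star b arm).bind pathEnds = ∑ p, farEnd b (arm p) :=
  bind_star pathEnds _ (pathEnds_through b) arm

theorem bind_pathEdges_star : (star b arm).bind pathEdges =
    (∑ p, first (arm p)).map (fun c => s(b, c)) + ∑ p, pathEdges (arm p) := by
  have hmap : (∑ p, first (arm p)).map (fun c => s(b, c)) =
      ∑ p, (first (arm p)).map fun c => s(b, c) :=
    map_sum (mapAddMonoidHom fun c => s(b, c)) _ _
  rw [bind_star pathEdges (fun l => pathEdges (b :: l)) (pathEdges_through b), hmap,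
    ← Finset.sum_add_distrib]
  rfl

theorem exists_eq_star_add.{u} {V : Type u} (b : V) (M : Multiset (List V)) :
    ∃ (ι : Type u) (_ : Fintype ι) (arm : ι × Bool → List V) (R : Multiset (List V)),
      M = star b arm + R ∧ ∀ r ∈ R, b ∉ r := by
  classical
  have hthrough (i : M.filter (b ∈ ·)) : ∃ arm, i.1 = through b arm :=
    exists_eq_through (mem_filter.1 coe_mem).2
  choose arm harm using hthrough
  refine ⟨M.filter (b ∈ ·), inferInstance, fun p => arm p.1 p.2, M.filter (b ∉ ·), ?_,
    fun r hr => (mem_filter.1 hr).2⟩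
  have hstar : star b (fun p => arm p.1 p.2) = M.filter (b ∈ ·) :=
    (map_congr rfl fun i _ => (harm i).symm).trans (map_univ_coe _)
  rw [hstar, filter_add_not]

theorem bind_pathEdges_reattach (harm : ∀ p, SamePath (arm p) (arm' p)) (hr : SamePath r r')
    (hfirst : ∑ p, first (arm' p) + first r' = ∑ p, first (arm p) + {x}) :
    (star b arm' + (b :: r') ::ₘ R).bind pathEdges =
      s(b, x) ::ₘ (star b arm + r ::ₘ R).bind pathEdges := by
  have hmap := congrArg (Multiset.map fun c => s(b, c)) hfirst
  rw [Multiset.map_add, Multiset.map_add, map_singleton] at hmap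
  rw [add_bind, add_bind, cons_bind, cons_bind, bind_pathEdges_star, bind_pathEdges_star,
    pathEdges_cons, hr.pathEdges_eq, Finset.sum_congr rfl fun p _ => (harm p).pathEdges_eq,
    ← Multiset.singleton_add]
  calc
    _ = ((∑ p, first (arm' p)).map (fun c => s(b, c)) + (first r').map (fun c => s(b, c))) +
        (∑ p, pathEdges (arm p) + pathEdges r + R.bind pathEdges) := by abel
    _ = _ := by rw [hmap]; abel

theorem cons_bind_pathEnds_reattach (harm : ∀ p, SamePath (arm p) (arm' p)) (hr : SamePath r r')
    (hne : r ≠ []) (hfirst : ∑ p, first (arm' p) + first r' = ∑ p, first (arm p) + {x}) :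
    x ::ₘ (star b arm' + (b :: r') ::ₘ R).bind pathEnds =
      b ::ₘ (star b arm + r ::ₘ R).bind pathEnds := by
  have hfar : ∑ p, farEnd b (arm' p) + ∑ p, first (arm' p) =
      ∑ p, farEnd b (arm p) + ∑ p, first (arm p) := by
    rw [← Finset.sum_add_distrib, ← Finset.sum_add_distrib]
    exact Finset.sum_congr rfl fun p _ => (harm p).farEnd_add_first_eq b
  have hfar_r : farEnd b r' + first r' = pathEnds r := by
    rw [hr.farEnd_add_first_eq, farEnd_add_first b hne]
  rw [add_bind, add_bind, cons_bind, cons_bind, bind_pathEnds_star, bind_pathEnds_star,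
    pathEnds_cons, ← Multiset.singleton_add, ← Multiset.singleton_add]
  refine add_right_cancel (b := ∑ p, first (arm p)) ?_
  calc
    _ = ∑ p, farEnd b (arm' p) + (∑ p, first (arm p) + {x}) + {b} + farEnd b r' +
        R.bind pathEnds := by abel
    _ = (∑ p, farEnd b (arm' p) + ∑ p, first (arm' p)) + {b} + (farEnd b r' + first r') +
        R.bind pathEnds := by rw [← hfirst]; abel
    _ = _ := by rw [hfar, hfar_r]; abel

namespace IsPathSystem

theorem nodup_cons_arm (h : IsPathSystem (star b arm + R) E D) (p : ι × Bool) :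
    (b :: arm p).Nodup :=
  nodup_cons_of_nodup_through
    (h.nodup _ (Multiset.mem_add.2 (.inl (mem_star.2 ⟨p.1, rfl⟩)))) p.2

theorem reattach (h : IsPathSystem (star b arm + r ::ₘ R) E D) (hbr : b ∉ r)
    (harm : ∀ p, SamePath (arm p) (arm' p)) (hr : SamePath r r')
    (hfirst : ∑ p, first (arm' p) + first r' = ∑ p, first (arm p) + {x}) :
    ∃ D', IsPathSystem (star b arm' + (b :: r') ::ₘ R) (s(b, x) ::ₘ E) D' ∧
      x ::ₘ D' = b ::ₘ D := by
  have hrR : r ∈ star b arm + r ::ₘ R := Multiset.mem_add.2 (.inr (mem_cons_self r R))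
  have hR : ∀ l ∈ R, l ∈ star b arm + r ::ₘ R := fun l hl =>
    Multiset.mem_add.2 (.inr (mem_cons_of_mem hl))
  refine ⟨_, ⟨fun l hl => ?_, fun l hl => ?_, ?_, rfl⟩, ?_⟩
  · rcases Multiset.mem_add.1 hl with hl | hl
    · obtain ⟨i, rfl⟩ := mem_star.1 hl
      simp [through]
    · rcases mem_cons.1 hl with rfl | hl
      exacts [List.cons_ne_nil _ _, h.ne_nil l (hR l hl)]
  · rcases Multiset.mem_add.1 hl with hl | hl
    · obtain ⟨i, rfl⟩ := mem_star.1 hl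
      exact (through_perm fun c => (harm (i, c)).perm).nodup_iff.2
        (h.nodup _ (Multiset.mem_add.2 (.inl (mem_star.2 ⟨i, rfl⟩))))
    · rcases mem_cons.1 hl with rfl | hl
      · exact List.nodup_cons.2 ⟨fun hb => hbr (hr.perm.mem_iff.1 hb),
          hr.perm.nodup_iff.2 (h.nodup r hrR)⟩
      · exact h.nodup l (hR l hl)
  · rw [bind_pathEdges_reattach harm hr hfirst, h.edges]
  · rw [cons_bind_pathEnds_reattach harm hr (h.ne_nil r hrR) hfirst, h.ends]

theorem add_edge (h : IsPathSystem M E D) (hE : (s(b, x) ::ₘ E).Nodup) (hbx : x ≠ b)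
    (hD : ∀ u, s(b, u) ∈ s(b, x) ::ₘ E → u ∈ D) :
    ∃ M' D', IsPathSystem M' (s(b, x) ::ₘ E) D' ∧ x ::ₘ D' = b ::ₘ D := by
  obtain ⟨ι, _, arm, R, rfl, hR⟩ := exists_eq_star_add b M
  have hattached : (x ::ₘ ∑ p, first (arm p)).map (fun c => s(b, c)) ≤ s(b, x) ::ₘ E := by
    rw [← h.edges, add_bind, bind_pathEdges_star, map_cons, cons_le_cons_iff, add_assoc]
    exact le_add_right _ _
  have hne : ∀ u ∈ x ::ₘ ∑ p, first (arm p), u ≠ b := by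
    intro u hu
    rcases mem_cons.1 hu with rfl | hu
    · exact hbx
    · obtain ⟨p, -, hp⟩ := mem_sum.1 hu
      exact fun hub => (List.nodup_cons.1 (h.nodup_cons_arm p)).1 (hub ▸ mem_of_mem_first hp)
  have hend : ∀ u ∈ x ::ₘ ∑ p, first (arm p),
      (∃ r ∈ R, u ∈ pathEnds r) ∨ ∃ p ∈ Finset.univ, u ∈ first (arm p).reverse := by
    intro u hu
    have huD := hD u (mem_of_le hattached (mem_map_of_mem _ hu))
    rw [← h.ends, add_bind, bind_pathEnds_star] at huD
    rcases Multiset.mem_add.1 huD with hu' | hu'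
    · obtain ⟨p, hp, hup⟩ := mem_sum.1 hu'
      rcases eq_or_ne (arm p) [] with hnil | hnil
      · rw [hnil] at hup
        exact absurd (mem_singleton.1 hup) (hne u hu)
      · exact .inr ⟨p, hp, farEnd_eq b hnil ▸ hup⟩
    · exact .inl (mem_bind.1 hu')
  obtain ⟨arm', harm', r, hr, r', hr', hfirst⟩ := exists_reversed_arms arm R Finset.univ x
    (.of_map _ (nodup_of_le hattached hE)) hend
  obtain ⟨R, rfl⟩ := exists_cons_of_mem hr
  obtain ⟨D', hsys, hD'⟩ := h.reattach (hR r hr) harm' hr' hfirst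
  exact ⟨_, D', hsys, hD'⟩

end IsPathSystem

end AddEdge

section PrescribedEnds

open SimpleGraph

variable {H : SimpleGraph V} {D : Multiset V}

theorem deleteEdges_lt {G : SimpleGraph V} {s : Set (Sym2 V)} {e : Sym2 V} (he : e ∈ G.edgeSet)
    (hs : e ∈ s) : G.deleteEdges s < G := by
  rw [← edgeSet_ssubset_edgeSet, edgeSet_deleteEdges]
  exact ⟨Set.sdiff_subset, fun h => (h he).2 hs⟩

theorem exists_adj_of_unique_notMem (hH : H ≠ ⊥)
    (hD : ∀ u v, H.Reachable u v → u ∉ D → v ∉ D → u = v) :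
    ∃ x b, H.Adj x b ∧ b ∈ D ∧ ∀ u, H.Reachable x u → u ∉ D → u = x := by
  by_cases h : ∃ v w, H.Adj v w ∧ v ∉ D
  · obtain ⟨v, w, hvw, hv⟩ := h
    exact ⟨v, w, hvw, not_not.1 fun hw => hvw.ne (hD v w hvw.reachable hv hw),
      fun u hu huD => (hD v u hu hv huD).symm⟩
  · push Not at h
    obtain ⟨x, b, hxb⟩ := ne_bot_iff_exists_adj.1 hH
    refine ⟨x, b, hxb, h b x hxb.symm, fun u hu huD => ?_⟩
    by_contra hne
    obtain ⟨w, huw⟩ := hu.nonempty_neighborSet_right (Ne.symm hne)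
    exact huD (h u w huw)

theorem eq_of_notMem_cons {x b : V} (hxb : H.Adj x b)
    (hD : ∀ u v, H.Reachable u v → u ∉ b ::ₘ D → v ∉ b ::ₘ D → u = v)
    (hx : ∀ u, H.Reachable x u → u ∉ b ::ₘ D → u = x) {u v : V} (huv : H.Reachable u v)
    (hu : u ∉ x ::ₘ D) (hv : v ∉ x ::ₘ D) : u = v := by
  have notMem_cons {w : V} (hw : w ∉ x ::ₘ D) (hwb : w ≠ b) : w ∉ b ::ₘ D := by
    rw [mem_cons, not_or]
    exact ⟨hwb, fun h => hw (mem_cons_of_mem h)⟩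
  have eq_b {w : V} (hw : w ∉ x ::ₘ D) (hxw : H.Reachable x w) : w = b := by
    by_contra hwb
    exact hw (hx w hxw (notMem_cons hw hwb) ▸ mem_cons_self x D)
  by_cases hxu : H.Reachable x u
  · rw [eq_b hu hxu, eq_b hv (hxu.trans huv)]
  · refine hD u v huv (notMem_cons hu ?_) (notMem_cons hv ?_)
    · exact fun h => hxu (h ▸ hxb.reachable)
    · exact fun h => hxu ((h ▸ hxb.reachable : H.Reachable x v).trans huv.symm)

theorem first_support {u v : V} (p : H.Walk u v) : first p.support = {u} := by
  cases p <;> rfl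

theorem pathEdges_support {u v : V} (p : H.Walk u v) :
    pathEdges p.support = (p.edges : Multiset (Sym2 V)) := by
  induction p with
  | nil => rfl
  | cons h p ih =>
    rw [Walk.support_cons, pathEdges_cons, ih, Walk.edges_cons, first_support, map_singleton,
      Multiset.singleton_add, cons_coe]

theorem pathEnds_support {u v : V} (p : H.Walk u v) : pathEnds p.support = {u, v} := by
  rw [pathEnds, ← Walk.support_reverse, first_support, first_support]
  rfl

variable [Finite V]

/-- The edges of a finite graph, as a multiset. -/
noncomputable def graphEdges (G : SimpleGraph V) : Multiset (Sym2 V) :=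
  G.edgeSet.toFinite.toFinset.val

theorem mem_graphEdges {G : SimpleGraph V} {e : Sym2 V} : e ∈ graphEdges G ↔ e ∈ G.edgeSet :=
  G.edgeSet.toFinite.mem_toFinset

theorem nodup_graphEdges (G : SimpleGraph V) : (graphEdges G).Nodup :=
  Finset.nodup _

theorem eq_graphEdges {G : SimpleGraph V} {E : Multiset (Sym2 V)} (hE : E.Nodup)
    (h : ∀ e, e ∈ E ↔ e ∈ G.edgeSet) : E = graphEdges G :=
  (Multiset.Nodup.ext hE (nodup_graphEdges G)).2 fun e => (h e).trans mem_graphEdges.symm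

theorem add_graphEdges_deleteEdges {G : SimpleGraph V} {E : Multiset (Sym2 V)} (hE : E.Nodup)
    {s : Set (Sym2 V)} (hs : s ⊆ G.edgeSet) (h : ∀ e, e ∈ E ↔ e ∈ s) :
    E + graphEdges (G.deleteEdges s) = graphEdges G := by
  have hmem (e : Sym2 V) : e ∈ graphEdges (G.deleteEdges s) ↔ e ∈ G.edgeSet \ s := by
    rw [mem_graphEdges, edgeSet_deleteEdges]
  refine eq_graphEdges ((Multiset.Nodup.add_iff hE (nodup_graphEdges _)).2 ?_) fun e => ?_
  · exact Multiset.disjoint_left.2 fun he he' => ((hmem _).1 he').2 ((h _).1 he)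
  · rw [Multiset.mem_add, hmem, h, ← Set.mem_union, Set.union_sdiff_cancel hs]

theorem exists_isPathSystem [DecidableEq V] (H : SimpleGraph V) (D : Multiset V)
    (hpar : ∀ v, Even (count v D + countP (v ∈ ·) (graphEdges H)))
    (hD : ∀ u v, H.Reachable u v → u ∉ D → v ∉ D → u = v) :
    ∃ M, IsPathSystem M (graphEdges H) D := by
  induction H using WellFoundedLT.induction generalizing D with
  | ind H ih =>
    rcases eq_or_ne H ⊥ with rfl | hH
    · have hE : graphEdges (⊥ : SimpleGraph V) = 0 := by simp [graphEdges]
      simp only [hE, countP_zero, add_zero] at hpar ⊢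
      obtain ⟨C, rfl⟩ := exists_smul_of_dvd_count D fun v _ => (hpar v).two_dvd
      exact ⟨_, .singletons C⟩
    obtain ⟨x, b, hxb, hbD, hx⟩ := exists_adj_of_unique_notMem hH hD
    obtain ⟨D, rfl⟩ := exists_cons_of_mem hbD
    have hbx : s(b, x) ∈ H.edgeSet := hxb.symm
    have hE : s(b, x) ::ₘ graphEdges (H.deleteEdges {s(b, x)}) = graphEdges H :=
      add_graphEdges_deleteEdges (nodup_singleton _) (Set.singleton_subset_iff.2 hbx)
        fun e => mem_singleton
    have hpar' : ∀ v, Even (count v (x ::ₘ D) +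
        countP (v ∈ ·) (graphEdges (H.deleteEdges {s(b, x)}))) := by
      intro v
      have hv := hpar v
      have hne := hxb.ne
      rw [← hE, count_cons, countP_cons] at hv
      simp only [Sym2.mem_iff] at hv
      rw [count_cons]
      grind
    obtain ⟨M, hM⟩ := ih (H.deleteEdges {s(b, x)}) (deleteEdges_lt hbx (Set.mem_singleton _))
      (x ::ₘ D) hpar' fun u v huv =>
      eq_of_notMem_cons hxb hD hx (huv.mono (deleteEdges_le _))
    have hend : ∀ u, s(b, u) ∈ s(b, x) ::ₘ graphEdges (H.deleteEdges {s(b, x)}) → u ∈ x ::ₘ D := by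
      intro u hu
      rw [hE, mem_graphEdges, mem_edgeSet] at hu
      by_contra huD
      rw [mem_cons, not_or] at huD
      refine huD.1 (hx u (hxb.reachable.trans hu.reachable) ?_)
      rw [mem_cons, not_or]
      exact ⟨hu.ne', huD.2⟩
    obtain ⟨M', D', hM', hD'⟩ := hM.add_edge (hE ▸ nodup_graphEdges H) hxb.ne hend
    rw [cons_swap, cons_inj_right] at hD'
    exact ⟨M', hE ▸ hD' ▸ hM'⟩

theorem IsPathSystem.exists_lt_of_even [DecidableEq V] {J : Multiset (List V)}
    {F : Multiset (Sym2 V)} (hJ : IsPathSystem J F D) (hD : D.Nodup)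
    (hodd : ∀ w ∈ D, Odd (countP (w ∈ ·) (graphEdges H))) {u v : V} (huv : H.Reachable u v)
    (hne : u ≠ v) (hu : Even (countP (u ∈ ·) (graphEdges H)))
    (hv : Even (countP (v ∈ ·) (graphEdges H))) :
    ∃ H' < H, ∃ J' F' D', IsPathSystem J' F' D' ∧ graphEdges H' + F' = graphEdges H + F ∧
      D'.Nodup ∧ ∀ w ∈ D', Odd (countP (w ∈ ·) (graphEdges H')) := by
  obtain ⟨p, hp⟩ := huv.exists_isPath
  have hpsys : IsPathSystem {p.support} (p.edges : Multiset (Sym2 V)) {u, v} := by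
    rw [← pathEdges_support, ← pathEnds_support p]
    exact .singleton p.support_ne_nil hp.support_nodup
  have hE := add_graphEdges_deleteEdges (coe_nodup.2 hp.isTrail.edges_nodup)
    (s := {e | e ∈ p.edges}) (fun e he => p.edges_subset_edgeSet he) fun e => mem_coe
  have huD : u ∉ D := fun h => Nat.not_even_iff_odd.2 (hodd u h) hu
  have hvD : v ∉ D := fun h => Nat.not_even_iff_odd.2 (hodd v h) hv
  have hlt : H.deleteEdges {e | e ∈ p.edges} < H := by
    cases p with
    | nil => exact absurd rfl hne
    | cons h p => exact deleteEdges_lt h List.mem_cons_self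
  refine ⟨_, hlt, _, _, _, hpsys.add hJ, ?_, ?_, fun w hw => ?_⟩
  · rw [← hE]
    abel
  · rw [insert_eq_cons, cons_add, Multiset.singleton_add]
    simp [hne, huD, hvD, hD]
  · have hpar := hpsys.even_count_add w
    have hcount := congrArg (countP (w ∈ ·)) hE
    rw [countP_add] at hcount
    rw [insert_eq_cons, count_cons, count_singleton] at hpar
    rw [insert_eq_cons, cons_add, Multiset.singleton_add, mem_cons, mem_cons] at hw
    have hwodd := hodd w
    grind

theorem exists_two_isPathSystem (H : SimpleGraph V) :
    ∃ (Q J : Multiset (List V)) (E F : Multiset (Sym2 V)) (C D : Multiset V),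
      IsPathSystem Q E C ∧ IsPathSystem J F D ∧ E + F = graphEdges H ∧ C.Nodup ∧ D.Nodup ∧
        D ⊆ C := by
  classical
  let := Fintype.ofFinite V
  obtain ⟨K, ⟨J, F, D, hJ, hF, hD, hodd⟩, hmin⟩ := exists_minimal_of_wellFoundedLT
    (fun K : SimpleGraph V => ∃ J F D, IsPathSystem J F D ∧ graphEdges K + F = graphEdges H ∧
      D.Nodup ∧ ∀ w ∈ D, Odd (countP (w ∈ ·) (graphEdges K)))
    ⟨H, 0, 0, 0, .zero, add_zero _, nodup_zero, fun w hw => absurd hw (notMem_zero w)⟩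
  let C : Finset V := {v | Odd (countP (v ∈ ·) (graphEdges K))}
  have mem_C {v : V} : v ∈ C.val ↔ Odd (countP (v ∈ ·) (graphEdges K)) := by simp [C]
  obtain ⟨Q, hQ⟩ := exists_isPathSystem K C.val
    (fun v => by
      rw [count_eq_of_nodup C.nodup]
      simp only [mem_C]
      grind)
    (fun u v huv hu hv => by
      by_contra hne
      rw [mem_C, Nat.not_odd_iff_even] at hu hv
      obtain ⟨K', hK', J', F', D', hJ', hF', hD'⟩ := hJ.exists_lt_of_even hD hodd huv hne hu hv
      exact hK'.not_ge (hmin ⟨J', F', D', hJ', hF'.trans hF, hD'⟩ hK'.le))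
  exact ⟨Q, J, _, F, C.val, D, hQ, hJ, hF, C.nodup, hD, fun v hv => mem_C.2 (hodd v hv)⟩

end PrescribedEnds

section Rooting

section Members

theorem bind_eq_sum {α β : Type*} [DecidableEq α] (M : Multiset α) (f : α → Multiset β) :
    M.bind f = ∑ i : M, f i :=
  congrArg Multiset.sum (map_univ M f).symm

theorem sum_le_bind {α β : Type*} [DecidableEq α] {M : Multiset α} (f : α → Multiset β)
    (X : Finset M) : ∑ i ∈ X, f i ≤ M.bind f := by
  rw [bind_eq_sum]
  exact Finset.sum_le_sum_of_subset (Finset.subset_univ X)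

theorem exists_coe_mem_of_mem_bind {α β : Type*} [DecidableEq α] {M : Multiset α}
    {f : α → Multiset β} {x : β} (h : x ∈ M.bind f) : ∃ i : M, x ∈ f i := by
  rw [bind_eq_sum, mem_sum] at h
  obtain ⟨i, -, hi⟩ := h
  exact ⟨i, hi⟩

theorem eq_of_mem_of_nodup_bind {α β : Type*} [DecidableEq α] {M : Multiset α}
    {f : α → Multiset β} (h : (M.bind f).Nodup) {i j : M} {x : β} (hi : x ∈ f i) (hj : x ∈ f j) :
    i = j := by
  classical
  by_contra hij
  have hnodup := nodup_of_le (sum_le_bind f {i, j}) h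
  rw [Finset.sum_pair hij] at hnodup
  exact disjoint_left.1 (nodup_add.1 hnodup).2.2 hi hj

namespace IsPathSystem

variable [DecidableEq V] {M : Multiset (List V)} {E : Multiset (Sym2 V)} {D : Multiset V}

theorem card_biUnion_pathEnds_le (h : IsPathSystem M E D) (X : Finset M) :
    (X.biUnion fun i => (pathEnds i.1).toFinset).card ≤ 2 * X.card := by
  rw [mul_comm]
  exact Finset.card_biUnion_le_card_mul _ _ _ fun i _ =>
    (toFinset_card_le _).trans (card_pathEnds (h.ne_nil i.1 coe_mem)).le

theorem card_biUnion_pathEnds (h : IsPathSystem M E D) (hD : D.Nodup) (X : Finset M) :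
    (X.biUnion fun i => (pathEnds i.1).toFinset).card = 2 * X.card := by
  have hends : X.biUnion (fun i => (pathEnds i.1).toFinset) =
      (∑ i ∈ X, pathEnds i.1).toFinset := by
    ext v
    simp [mem_sum]
  rw [hends, toFinset_card_of_nodup (nodup_of_le (sum_le_bind _ X) (h.ends ▸ hD)), card_sum,
    Finset.sum_congr rfl fun i _ => card_pathEnds (h.ne_nil i.1 coe_mem), Finset.sum_const,
    smul_eq_mul, mul_comm]

end IsPathSystem

end Members

theorem IsPathSystem.exists_common_ends [DecidableEq V] {Q J : Multiset (List V)}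
    {E F : Multiset (Sym2 V)} {C D : Multiset V} (hQ : IsPathSystem Q E C)
    (hJ : IsPathSystem J F D) (hD : D.Nodup) (hDC : D ⊆ C) :
    ∃ (g : J → Q) (u : J → V), Function.Injective g ∧
      ∀ j, u j ∈ pathEnds j.1 ∧ u j ∈ pathEnds (g j).1 := by
  classical
  let partners (j : J) : Finset Q := {q | ∃ u ∈ pathEnds j.1, u ∈ pathEnds q.1}
  have hall (X : Finset J) : X.card ≤ (X.biUnion partners).card := by
    have hends : X.biUnion (fun j => (pathEnds j.1).toFinset) ⊆
        (X.biUnion partners).biUnion fun q => (pathEnds q.1).toFinset := by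
      refine Finset.biUnion_subset.2 fun j hj v hv => ?_
      rw [mem_toFinset] at hv
      have hvC : v ∈ C := hDC (hJ.ends ▸ mem_bind.2 ⟨j.1, coe_mem, hv⟩)
      obtain ⟨q, hq⟩ := exists_coe_mem_of_mem_bind (hQ.ends ▸ hvC)
      have hqj : q ∈ partners j := Finset.mem_filter.2 ⟨Finset.mem_univ q, v, hv, hq⟩
      exact Finset.mem_biUnion.2
        ⟨q, Finset.mem_biUnion.2 ⟨j, hj, hqj⟩, mem_toFinset.2 hq⟩
    have hcard := Finset.card_le_card hends
    have hle := hQ.card_biUnion_pathEnds_le (X.biUnion partners)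
    rw [hJ.card_biUnion_pathEnds hD] at hcard
    omega
  obtain ⟨g, hg, hgmem⟩ := (Finset.all_card_le_biUnion_card_iff_exists_injective partners).1 hall
  choose u huJ huQ using fun j => (Finset.mem_filter.1 (hgmem j)).2
  exact ⟨g, u, hg, fun j => ⟨huJ j, huQ j⟩⟩

variable [Fintype V]

/-- A family of paths with edges `E`, one path `v :: A v` starting at each vertex `v`. -/
structure IsRootedFamily (A : V → List V) (E : Multiset (Sym2 V)) : Prop where
  nodup : ∀ v, (v :: A v).Nodup
  edges : ∑ v, pathEdges (v :: A v) = E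

theorem exists_isRootedFamily {ι : Type*} [Fintype ι] {l : ι → List V} {f : ι → V}
    (hf : Function.Injective f) (hl : ∀ i, (l i).Nodup) (hfl : ∀ i, f i ∈ pathEnds (l i)) :
    ∃ A, IsRootedFamily A (∑ i, pathEdges (l i)) ∧ ∀ v ∉ Set.range f, A v = [] := by
  choose t ht using fun i => exists_samePath_cons (hfl i)
  have hA (v : V) (hv : v ∉ Set.range f) : Function.extend f t (fun _ => []) v = [] :=
    Function.extend_apply' _ _ _ hv
  refine ⟨Function.extend f t fun _ => [], ⟨fun v => ?_, ?_⟩, hA⟩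
  · by_cases hv : v ∈ Set.range f
    · obtain ⟨i, rfl⟩ := hv
      rw [hf.extend_apply]
      exact (ht i).perm.nodup_iff.2 (hl i)
    · rw [hA v hv]
      exact List.nodup_singleton v
  · refine (Fintype.sum_of_injective f hf _ _ (fun v hv => ?_) fun i => ?_).symm
    · rw [hA v hv, pathEdges_singleton]
    · rw [hf.extend_apply, (ht i).pathEdges_eq]

theorem exists_rooted_paths (H : SimpleGraph V) : ∃ A, IsRootedFamily A (graphEdges H) := by
  classical
  obtain ⟨Q, J, E, F, C, D, hQ, hJ, hEF, hC, hD, -⟩ := exists_two_isPathSystem H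
  let l : Q ⊕ J → List V := Sum.elim (fun i => i.1) (fun i => i.1)
  have hl : ∀ i, (l i).Nodup := by
    rintro (i | i)
    exacts [hQ.nodup _ coe_mem, hJ.nodup _ coe_mem]
  have hall (X : Finset (Q ⊕ J)) :
      X.card ≤ (X.biUnion fun i => (pathEnds (l i)).toFinset).card := by
    have hleft : 2 * X.toLeft.card ≤ (X.biUnion fun i => (pathEnds (l i)).toFinset).card := by
      rw [← hQ.card_biUnion_pathEnds hC]
      refine Finset.card_le_card (Finset.biUnion_subset.2 fun i hi => ?_)
      exact Finset.subset_biUnion_of_mem (fun i => (pathEnds (l i)).toFinset)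
        (Finset.mem_toLeft.1 hi)
    have hright : 2 * X.toRight.card ≤ (X.biUnion fun i => (pathEnds (l i)).toFinset).card := by
      rw [← hJ.card_biUnion_pathEnds hD]
      refine Finset.card_le_card (Finset.biUnion_subset.2 fun i hi => ?_)
      exact Finset.subset_biUnion_of_mem (fun i => (pathEnds (l i)).toFinset)
        (Finset.mem_toRight.1 hi)
    have hcard := Finset.card_toLeft_add_card_toRight (u := X)
    omega
  obtain ⟨f, hf, hfl⟩ := (Finset.all_card_le_biUnion_card_iff_exists_injective _).1 hall
  obtain ⟨A, hA, -⟩ := exists_isRootedFamily hf hl fun i => mem_toFinset.1 (hfl i)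
  rw [Fintype.sum_sum_type] at hA
  rw [← hEF, ← hQ.edges, ← hJ.edges, bind_eq_sum, bind_eq_sum]
  exact ⟨A, hA⟩

theorem exists_rooted_pairs (H : SimpleGraph V) :
    ∃ (S : Finset V) (B C : V → List V) (F : Multiset (List V)) (EB EC EF : Multiset (Sym2 V))
      (DF : Multiset V), IsRootedFamily B EB ∧ IsRootedFamily C EC ∧ IsPathSystem F EF DF ∧
        EB + EC + EF = graphEdges H ∧ 2 * (S.card + card F) ≤ Fintype.card V ∧
        ∀ v ∉ S, B v = [] ∧ C v = [] := by
  classical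
  obtain ⟨Q, J, E, E', D, D', hQ, hJ, hE, hD, hD', hDD⟩ := exists_two_isPathSystem H
  obtain ⟨g, u, hg, hu⟩ := hQ.exists_common_ends hJ hD' hDD
  have hu_inj : Function.Injective u := fun i j hij =>
    eq_of_mem_of_nodup_bind (hJ.ends ▸ hD') (hu i).1 (hij ▸ (hu j).1)
  obtain ⟨F, hF⟩ : ∃ F, Q = (Finset.univ : Finset J).val.map (fun j => (g j).1) + F := by
    have hle : (Finset.univ : Finset J).val.map g ≤ (Finset.univ : Finset Q).val :=
      (le_iff_subset (Finset.univ.nodup.map hg)).2 fun q _ => Finset.mem_univ_val q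
    have hle := map_le_map (f := fun q : Q => q.1) hle
    rw [Multiset.map_map, map_univ_coe] at hle
    exact Multiset.le_iff_exists_add.1 hle
  obtain ⟨B, hB, hB_nil⟩ := exists_isRootedFamily hu_inj (fun j => hJ.nodup j.1 coe_mem)
    fun j => (hu j).1
  obtain ⟨C, hC, hC_nil⟩ := exists_isRootedFamily hu_inj (fun j => hQ.nodup (g j).1 coe_mem)
    fun j => (hu j).2
  have hrange {v : V} (hv : v ∉ Finset.univ.image u) : v ∉ Set.range u := by simpa using hv
  refine ⟨Finset.univ.image u, B, C, F, _, _, _, _, hB, hC,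
    hQ.of_le (hF ▸ le_add_left F _), ?_, ?_,
    fun v hv => ⟨hB_nil v (hrange hv), hC_nil v (hrange hv)⟩⟩
  · have hQE := hQ.edges
    rw [hF, add_bind, Multiset.bind_map] at hQE
    rw [← hE, ← hQE, ← hJ.edges, bind_eq_sum J, add_assoc, add_comm]
    rfl
  · have hcard := congrArg card hF
    rw [card_add, card_map, Finset.card_val, Finset.card_univ] at hcard
    rw [Finset.card_image_of_injective _ hu_inj, Finset.card_univ, ← hcard, ← hQ.card_ends,
      ← toFinset_card_of_nodup hD]
    exact Finset.card_le_univ _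

end Rooting

section Decompositions

open SimpleGraph

variable {G : SimpleGraph V}

theorem nodup_sum {ι α : Type*} {s : Finset ι} {f : ι → Multiset α} (h : ∀ i ∈ s, (f i).Nodup)
    (hdisj : ∀ i ∈ s, ∀ j ∈ s, ∀ x ∈ f i, x ∈ f j → i = j) : (∑ i ∈ s, f i).Nodup :=
  nodup_bind.2 ⟨h, Multiset.Nodup.pairwise (fun i hi j hj hij =>
    disjoint_left.2 fun hxi hxj => hij (hdisj i hi j hj _ hxi hxj)) s.nodup⟩

theorem exists_list_of_isPathSubgraph {S : G.Subgraph} (hS : S.IsPathSubgraph) :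
    ∃ l : List V, l ≠ [] ∧ l.Nodup ∧ (pathEdges l).Nodup ∧
      ∀ e, e ∈ pathEdges l ↔ e ∈ S.edgeSet := by
  obtain ⟨u, v, p, hp, rfl⟩ := hS
  refine ⟨p.support, p.support_ne_nil, hp.support_nodup, ?_, fun e => ?_⟩
  · rw [pathEdges_support]
    exact coe_nodup.2 hp.isTrail.edges_nodup
  · rw [pathEdges_support, mem_coe, Walk.mem_edges_toSubgraph]

theorem exists_walk_support_eq {l : List V} (hl : l ≠ [])
    (h : ∀ e ∈ pathEdges l, e ∈ G.edgeSet) : ∃ (u v : V) (p : G.Walk u v), p.support = l := by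
  induction l with
  | nil => exact absurd rfl hl
  | cons a l ih =>
    cases l with
    | nil => exact ⟨a, a, Walk.nil, rfl⟩
    | cons c l =>
      rw [pathEdges_cons_cons] at h
      have hac : G.Adj a c := h _ (mem_cons_self _ _)
      obtain ⟨u, v, p, hp⟩ := ih (List.cons_ne_nil c l) fun e he => h e (mem_cons_of_mem he)
      obtain rfl : u = c := by
        rw [← singleton_inj, ← first_support p, hp, first_cons]
      exact ⟨a, v, Walk.cons hac p, by rw [Walk.support_cons, hp]⟩

theorem exists_isPathSystem_of_isPathDecomposition [Finite V] {P : Finset G.Subgraph}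
    (hP : G.IsPathDecomposition P) :
    ∃ M D, IsPathSystem M (graphEdges G) D ∧ card M = P.card := by
  choose! l hne hnodup hedges hmem using
    fun S hS => exists_list_of_isPathSubgraph (hP.isPath S hS)
  refine ⟨P.val.map l, _, ⟨?_, ?_, ?_, rfl⟩, card_map l P.val⟩
  · intro l' hl'
    obtain ⟨S, hS, rfl⟩ := mem_map.1 hl'
    exact hne S hS
  · intro l' hl'
    obtain ⟨S, hS, rfl⟩ := mem_map.1 hl'
    exact hnodup S hS
  · rw [Multiset.bind_map]
    refine eq_graphEdges (nodup_sum hedges fun S hS T hT e he he' => ?_) fun e => ?_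
    · by_contra hST
      exact Set.disjoint_left.1 (hP.edgeDisjoint S hS T hT hST) ((hmem S hS e).1 he)
        ((hmem T hT e).1 he')
    · rw [mem_bind]
      constructor
      · rintro ⟨S, hS, he⟩
        exact S.edgeSet_subset ((hmem S hS e).1 he)
      · intro he
        obtain ⟨S, hS, heS⟩ := hP.cover e he
        exact ⟨S, hS, (hmem S hS e).2 heS⟩

theorem IsPathSystem.pathNumber_le [Finite V] {M : Multiset (List V)} {D : Multiset V}
    (h : IsPathSystem M (graphEdges G) D) : G.pathNumber ≤ card M := by
  classical
  have hwalk (i : M) : ∃ (u v : V) (p : G.Walk u v), p.support = i.1 :=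
    exists_walk_support_eq (h.ne_nil _ coe_mem) fun e he =>
      mem_graphEdges.1 (h.edges ▸ mem_bind.2 ⟨i.1, coe_mem, he⟩)
  choose u v p hp using hwalk
  have hmem (i : M) (e : Sym2 V) : e ∈ (p i).toSubgraph.edgeSet ↔ e ∈ pathEdges i.1 := by
    rw [← hp i, pathEdges_support, mem_coe, Walk.mem_edges_toSubgraph]
  have hdec : G.IsPathDecomposition (Finset.univ.image fun i => (p i).toSubgraph) := by
    refine ⟨fun S hS => ?_, fun S hS T hT hST => ?_, fun e he => ?_⟩
    · obtain ⟨i, -, rfl⟩ := Finset.mem_image.1 hS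
      exact ⟨u i, v i, p i, .mk' (hp i ▸ h.nodup _ coe_mem), rfl⟩
    · obtain ⟨i, -, rfl⟩ := Finset.mem_image.1 hS
      obtain ⟨j, -, rfl⟩ := Finset.mem_image.1 hT
      refine Set.disjoint_left.2 fun e he he' => hST ?_
      rw [eq_of_mem_of_nodup_bind (h.edges ▸ nodup_graphEdges G) ((hmem i e).1 he)
        ((hmem j e).1 he')]
    · rw [← mem_graphEdges, ← h.edges] at he
      obtain ⟨i, hi⟩ := exists_coe_mem_of_mem_bind he
      exact ⟨_, Finset.mem_image_of_mem _ (Finset.mem_univ i), (hmem i e).2 hi⟩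
  calc
    G.pathNumber ≤ _ := Nat.sInf_le ⟨_, hdec, rfl⟩
    _ ≤ Fintype.card M := Finset.card_image_le
    _ = card M := card_coe M

theorem countP_graphEdges [Fintype V] [DecidableEq V] [DecidableRel G.Adj] (v : V) :
    countP (v ∈ ·) (graphEdges G) = G.degree v := by
  rw [← card_incidenceFinset_eq_degree, countP_eq_card_filter, graphEdges, ← Finset.filter_val,
    Finset.card_val]
  congr 1
  ext e
  simp [incidenceSet]

theorem exists_isPathSystem_odd [Fintype V] [DecidableRel G.Adj]
    (hp : 2 * G.pathNumber = G.oddVertexCount) :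
    ∃ M, IsPathSystem M (graphEdges G) (Finset.univ.filter fun v => Odd (G.degree v)).val := by
  classical
  obtain ⟨P, hP, hPcard⟩ := G.exists_isPathDecomposition_card_eq_pathNumber
  obtain ⟨M, D, hM, hMcard⟩ := exists_isPathSystem_of_isPathDecomposition hP
  have hle : (Finset.univ.filter fun v => Odd (G.degree v)).val ≤ D := by
    refine (le_iff_subset (Finset.nodup _)).2 fun v hv => ?_
    have hodd : Odd (G.degree v) := (Finset.mem_filter.1 hv).2
    have heven := hM.even_count_add v
    rw [countP_graphEdges] at heven
    by_contra hvD
    rw [count_eq_zero_of_notMem hvD, zero_add] at heven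
    exact Nat.not_even_iff_odd.2 hodd heven
  have hD : (Finset.univ.filter fun v => Odd (G.degree v)).val = D :=
    eq_of_le_of_card_le hle (by rw [hM.card_ends, hMcard, hPcard, hp]; rfl)
  exact ⟨M, hD ▸ hM⟩

end Decompositions

section Cut

variable {M : Multiset (List V)} {E : Multiset (Sym2 V)} {D : Multiset V}

theorem nodup_pathEnds_cons {b : V} {l : List V} (h : b ∉ farEnd b l) :
    (pathEnds (b :: l)).Nodup := by
  obtain ⟨c, hc⟩ : ∃ c, farEnd b l = {c} := exists_first_eq (by simp)
  rw [pathEnds_cons, Multiset.singleton_add, nodup_cons]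
  exact ⟨h, hc ▸ nodup_singleton c⟩

namespace IsPathSystem

theorem exists_cut_at (h : IsPathSystem M E D) (hM : ∀ l ∈ M, (pathEnds l).Nodup) {v : V}
    (hvD : v ∉ D) {e : Sym2 V} (he : e ∈ E) (hve : v ∈ e) :
    ∃ M', IsPathSystem M' E (v ::ₘ v ::ₘ D) ∧ (∀ l ∈ M', (pathEnds l).Nodup) ∧
      card M' = card M + 1 := by
  obtain ⟨l, hl, hel⟩ := mem_bind.1 (h.edges ▸ he)
  obtain ⟨arm, rfl⟩ := exists_eq_through (mem_of_mem_pathEdges hel hve)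
  obtain ⟨M, rfl⟩ := exists_cons_of_mem hl
  have harm := nodup_cons_of_nodup_through (h.nodup _ hl)
  have hfar (c : Bool) : v ∉ farEnd v (arm c) := fun hv => hvD <| by
    rw [← h.ends, mem_bind]
    exact ⟨_, hl, by rw [pathEnds_through, mem_sum]; exact ⟨c, Finset.mem_univ c, hv⟩⟩
  have hcut := ((h.of_le (le_cons_self M _)).cons (List.cons_ne_nil _ _) (harm false)).cons
    (List.cons_ne_nil _ _) (harm true)
  refine ⟨(v :: arm true) ::ₘ (v :: arm false) ::ₘ M, ?_, ?_, by simp only [card_cons]⟩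
  · convert hcut using 1
    · rw [← h.edges, cons_bind, pathEdges_through, Fintype.sum_bool, add_assoc]
    · rw [← h.ends, cons_bind, pathEnds_through, Fintype.sum_bool, pathEnds_cons, pathEnds_cons,
        ← Multiset.singleton_add, ← Multiset.singleton_add]
      abel
  · simp only [mem_cons, forall_eq_or_imp]
    exact ⟨nodup_pathEnds_cons (hfar true), nodup_pathEnds_cons (hfar false),
      fun l hl => hM l (mem_cons_of_mem hl)⟩

theorem exists_cut (h : IsPathSystem M E D) (hM : ∀ l ∈ M, (pathEnds l).Nodup) (Z : Finset V)
    (hZD : ∀ v ∈ Z, v ∉ D) (hZE : ∀ v ∈ Z, ∃ e ∈ E, v ∈ e) :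
    ∃ M', IsPathSystem M' E (Z.val + Z.val + D) ∧ (∀ l ∈ M', (pathEnds l).Nodup) ∧
      card M' = card M + Z.card := by
  classical
  induction Z using Finset.induction_on with
  | empty => exact ⟨M, by simpa using h, hM, rfl⟩
  | insert v Z hv ih =>
    obtain ⟨M', hM', hends, hcard⟩ := ih (fun u hu => hZD u (Finset.mem_insert_of_mem hu))
      fun u hu => hZE u (Finset.mem_insert_of_mem hu)
    obtain ⟨e, he, hve⟩ := hZE v (Finset.mem_insert_self v Z)
    have hvD : v ∉ Z.val + Z.val + D := by
      simp [hv, hZD v (Finset.mem_insert_self v Z)]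
    obtain ⟨M'', hM'', hends', hcard'⟩ := hM'.exists_cut_at hends hvD he hve
    refine ⟨M'', ?_, hends', by rw [hcard', hcard, Finset.card_insert_of_notMem hv, add_assoc]⟩
    rwa [Finset.insert_val_of_notMem hv, cons_add, cons_add, add_cons, cons_add]

end IsPathSystem

end Cut

section BoxProd

open SimpleGraph

/-- The images of edges under a map of the vertices. -/
def mapEdges (f : V → W) : Multiset (Sym2 V) →+ Multiset (Sym2 W) := mapAddMonoidHom (Sym2.map f)

theorem mem_mapEdges {f : V → W} {E : Multiset (Sym2 V)} {e : Sym2 W} :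
    e ∈ mapEdges f E ↔ ∃ e' ∈ E, Sym2.map f e' = e := mem_map

theorem pathEdges_map (f : V → W) (l : List V) :
    pathEdges (l.map f) = mapEdges f (pathEdges l) := by
  induction l with
  | nil => rfl
  | cons a l ih =>
    rw [List.map_cons, pathEdges_cons, pathEdges_cons, ih, _root_.map_add]
    cases l <;> rfl

theorem IsPathSystem.exists_map {f : V → W} (hf : Function.Injective f) {M : Multiset (List V)}
    {E : Multiset (Sym2 V)} {D : Multiset V} (h : IsPathSystem M E D) :
    ∃ D', IsPathSystem (M.map (List.map f)) (mapEdges f E) D' := by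
  refine ⟨_, fun l' hl' => ?_, fun l' hl' => ?_, ?_, rfl⟩
  · obtain ⟨l, hl, rfl⟩ := mem_map.1 hl'
    exact mt List.map_eq_nil_iff.1 (h.ne_nil l hl)
  · obtain ⟨l, hl, rfl⟩ := mem_map.1 hl'
    exact (h.nodup l hl).map hf
  · rw [Multiset.bind_map, ← h.edges, bind_congr fun l _ => pathEdges_map f l]
    exact (map_bind M pathEdges (Sym2.map f)).symm

section Join

variable {a z : V} {m : List V} {w : W} {s t : List W}

/-- The path `a, m, z` in the copy of `V` at `w`, continued at both ends by the paths `w :: s` and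
`w :: t` in the copies of `W` at `a` and `z`. -/
def joinedPath (a z : V) (m : List V) (w : W) (s t : List W) : List (V × W) :=
  (s.map (a, ·)).reverse ++ ((a :: (m ++ [z])).map (·, w) ++ t.map (z, ·))

theorem nodup_joinedPath (hm : (a :: (m ++ [z])).Nodup) (hs : (w :: s).Nodup)
    (ht : (w :: t).Nodup) : (joinedPath a z m w s t).Nodup := by
  obtain ⟨hws, hs⟩ := List.nodup_cons.1 hs
  obtain ⟨hwt, ht⟩ := List.nodup_cons.1 ht
  have haz : a ≠ z := by
    rintro rfl
    simp at hm
  refine List.nodup_append'.2 ⟨List.nodup_reverse.2 (hs.map (Prod.mk_right_injective a)),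
    List.nodup_append'.2 ⟨hm.map (Prod.mk_left_injective w),
      ht.map (Prod.mk_right_injective z), ?_⟩, ?_⟩
  · rintro ⟨x, y⟩ hx hy
    simp only [List.mem_map, Prod.mk.injEq] at hx hy
    obtain ⟨-, -, -, rfl⟩ := hx
    obtain ⟨y', hy', -, rfl⟩ := hy
    exact hwt hy'
  · rintro ⟨x, y⟩ hx hy
    simp only [List.mem_reverse, List.mem_append, List.mem_map, Prod.mk.injEq] at hx hy
    obtain ⟨y', hy', rfl, rfl⟩ := hx
    obtain ⟨-, -, -, rfl⟩ | ⟨-, -, rfl, -⟩ := hy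
    · exact hws hy'
    · exact haz rfl

theorem pathEdges_joinedPath : pathEdges (joinedPath a z m w s t) =
    mapEdges (·, w) (pathEdges (a :: (m ++ [z]))) +
      (mapEdges (a, ·) (pathEdges (w :: s)) + mapEdges (z, ·) (pathEdges (w :: t))) := by
  have hjoined : joinedPath a z m w s t = through (a, w) fun c =>
      bif c then m.map (·, w) ++ (z, w) :: t.map (z, ·) else s.map (a, ·) := by
    simp [joinedPath, through]
  have hright : pathEdges ((a, w) :: (m.map (·, w) ++ (z, w) :: t.map (z, ·))) =
      pathEdges ((a :: (m ++ [z])).map (·, w)) + pathEdges ((w :: t).map (z, ·)) := by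
    rw [← List.cons_append, pathEdges_append_cons]
    simp
  have hleft : pathEdges ((a, w) :: s.map (a, ·)) = pathEdges ((w :: s).map (a, ·)) := rfl
  rw [hjoined, pathEdges_through, Fintype.sum_bool, cond_true, cond_false, hright, hleft,
    pathEdges_map, pathEdges_map, pathEdges_map]
  abel

theorem IsPathSystem.exists_join {M : Multiset (List V)} {E : Multiset (Sym2 V)} {D : Multiset V}
    (h : IsPathSystem M E D) (hM : ∀ l ∈ M, (pathEnds l).Nodup) (T : Multiset (V × List W))
    (hTD : T.map Prod.fst = D) (hT : ∀ p ∈ T, (w :: p.2).Nodup) :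
    ∃ N D', IsPathSystem N (mapEdges (·, w) E +
      T.bind fun p => mapEdges (p.1, ·) (pathEdges (w :: p.2))) D' ∧ card N = card M := by
  classical
  induction M using Multiset.induction_on generalizing E D T with
  | empty =>
    obtain rfl : E = 0 := h.edges.symm
    obtain rfl : D = 0 := h.ends.symm
    obtain rfl : T = 0 := Multiset.map_eq_zero.1 hTD
    exact ⟨0, 0, .zero, rfl⟩
  | cons l M ih =>
    have hl := mem_cons_self l M
    obtain ⟨a, z, haz⟩ := card_eq_two.1 (card_pathEnds (h.ne_nil l hl))
    have haz_ne : a ≠ z := by simpa [haz] using hM l hl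
    have hD := h.ends
    rw [cons_bind, haz, insert_eq_cons, cons_add, Multiset.singleton_add, ← hTD] at hD
    obtain ⟨⟨a, s⟩, hs, rfl, hTs⟩ := (Multiset.map_eq_cons _ _ _ _).2 hD.symm
    obtain ⟨T, rfl⟩ := exists_cons_of_mem hs
    rw [erase_cons_head] at hTs
    obtain ⟨⟨z, t⟩, ht, rfl, hTt⟩ := (Multiset.map_eq_cons _ _ _ _).2 hTs
    obtain ⟨T, rfl⟩ := exists_cons_of_mem ht
    rw [erase_cons_head] at hTt
    obtain ⟨N, D', hN, hcard⟩ := ih (h.of_le (le_cons_self M l))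
      (fun l' hl' => hM l' (mem_cons_of_mem hl')) T hTt
      fun p hp => hT p (mem_cons_of_mem (mem_cons_of_mem hp))
    obtain ⟨m, hm⟩ := exists_samePath_cons_concat haz haz_ne
    have hnodup := nodup_joinedPath (hm.perm.nodup_iff.2 (h.nodup l hl)) (hT _ (mem_cons_self _ _))
      (hT _ (mem_cons_of_mem (mem_cons_self _ _)))
    have hcons := hN.cons (by simp [joinedPath]) hnodup
    refine ⟨joinedPath a z m w s t ::ₘ N, pathEnds (joinedPath a z m w s t) + D', ?_,
      by rw [card_cons, card_cons, hcard]⟩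
    convert hcons using 1
    rw [pathEdges_joinedPath, hm.pathEdges_eq, ← h.edges, cons_bind, cons_bind, cons_bind,
      _root_.map_add]
    abel

end Join

theorem mk_mem_mapEdges_graphEdges [Finite V] {G : SimpleGraph V} {f : V → W} {x y : W} :
    s(x, y) ∈ mapEdges f (graphEdges G) ↔ ∃ u v, G.Adj u v ∧ f u = x ∧ f v = y := by
  rw [mem_mapEdges]
  refine ⟨fun ⟨e, he, hxy⟩ => ?_, fun ⟨u, v, huv, hx, hy⟩ =>
    ⟨s(u, v), mem_graphEdges.2 huv, by rw [Sym2.map_mk, hx, hy]⟩⟩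
  induction e with
  | _ u v =>
    have huv : G.Adj u v := mem_graphEdges.1 he
    obtain ⟨hx, hy⟩ | ⟨hy, hx⟩ := Sym2.eq_iff.1 hxy
    · exact ⟨u, v, huv, hx, hy⟩
    · exact ⟨v, u, huv.symm, hx, hy⟩

theorem nodup_sum_mapEdges_graphEdges {ι : Type*} [Finite V] [Fintype ι] (G : SimpleGraph V)
    {f : ι → V → W} (hf : ∀ i, Function.Injective (f i))
    (hdisj : ∀ i j u v, f i u = f j v → i = j) :
    (∑ i, mapEdges (f i) (graphEdges G)).Nodup := by
  refine nodup_sum (fun i _ => (nodup_graphEdges G).map (Sym2.map.injective (hf i)))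
    fun i _ j _ e hi hj => ?_
  induction e with
  | _ x y =>
    obtain ⟨u, -, -, hu, -⟩ := mk_mem_mapEdges_graphEdges.1 hi
    obtain ⟨v, -, -, hv, -⟩ := mk_mem_mapEdges_graphEdges.1 hj
    exact hdisj i j u v (hu.trans hv.symm)

theorem graphEdges_boxProd [Fintype V] [Fintype W] (G : SimpleGraph V) (H : SimpleGraph W) :
    graphEdges (G.boxProd H) =
      ∑ w, mapEdges (·, w) (graphEdges G) + ∑ v, mapEdges (v, ·) (graphEdges H) := by
  refine (eq_graphEdges (nodup_add.2 ⟨?_, ?_, ?_⟩) fun e => ?_).symm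
  · exact nodup_sum_mapEdges_graphEdges G Prod.mk_left_injective fun _ _ _ _ h => (Prod.mk.inj h).2
  · exact nodup_sum_mapEdges_graphEdges H Prod.mk_right_injective fun _ _ _ _ h => (Prod.mk.inj h).1
  · refine disjoint_left.2 fun {e} hG hH => ?_
    obtain ⟨w, -, hG⟩ := mem_sum.1 hG
    obtain ⟨v, -, hH⟩ := mem_sum.1 hH
    induction e with
    | _ x y =>
      obtain ⟨a, b, hab, rfl, rfl⟩ := mk_mem_mapEdges_graphEdges.1 hG
      obtain ⟨c, d, -, hc, hd⟩ := mk_mem_mapEdges_graphEdges.1 hH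
      exact hab.ne ((Prod.mk.inj hc).1.symm.trans (Prod.mk.inj hd).1)
  · induction e with
    | _ x y =>
      obtain ⟨a, c⟩ := x
      obtain ⟨b, d⟩ := y
      simp only [Multiset.mem_add, mem_sum, mk_mem_mapEdges_graphEdges, mem_edgeSet, boxProd_adj,
        Prod.mk.injEq]
      aesop

theorem sum_layers_add [Fintype V] [DecidableEq V] [Fintype W] (G : SimpleGraph V) (O : Finset V)
    {H : SimpleGraph W} {A B C : W → List W} {EB EC EF : Multiset (Sym2 W)}
    (hA : IsRootedFamily A (graphEdges H)) (hB : IsRootedFamily B EB) (hC : IsRootedFamily C EC)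
    (hBCF : EB + EC + EF = graphEdges H) :
    ∑ w, (mapEdges (·, w) (graphEdges G) + (∑ v ∈ O, mapEdges (v, ·) (pathEdges (w :: A w)) +
        ∑ v ∈ Oᶜ, mapEdges (v, ·) (pathEdges (w :: B w) + pathEdges (w :: C w)))) +
      ∑ v ∈ Oᶜ, mapEdges (v, ·) EF = graphEdges (G.boxProd H) := by
  have hO : ∑ w, ∑ v ∈ O, mapEdges (v, ·) (pathEdges (w :: A w)) =
      ∑ v ∈ O, mapEdges (v, ·) (graphEdges H) := by
    rw [Finset.sum_comm]
    simp only [← map_sum, hA.edges]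
  have hOc : ∑ w, ∑ v ∈ Oᶜ, mapEdges (v, ·) (pathEdges (w :: B w) + pathEdges (w :: C w)) +
      ∑ v ∈ Oᶜ, mapEdges (v, ·) EF = ∑ v ∈ Oᶜ, mapEdges (v, ·) (graphEdges H) := by
    rw [Finset.sum_comm, ← Finset.sum_add_distrib]
    simp only [← map_sum, ← _root_.map_add, Finset.sum_add_distrib, hB.edges, hC.edges, hBCF]
  rw [Finset.sum_add_distrib, Finset.sum_add_distrib, hO, add_assoc, add_assoc, hOc,
    Finset.sum_add_sum_compl, graphEdges_boxProd]

theorem IsPathSystem.exists_layer [Fintype V] [DecidableEq V] {M : Multiset (List V)}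
    {E : Multiset (Sym2 V)} {O : Finset V} (h : IsPathSystem M E O.val)
    (hE : ∀ v, ∃ e ∈ E, v ∈ e) {S : Finset W} [DecidableEq W] {w : W} {a b c : List W}
    (ha : (w :: a).Nodup) (hb : (w :: b).Nodup) (hc : (w :: c).Nodup)
    (hbc : w ∉ S → b = [] ∧ c = []) :
    ∃ N D', IsPathSystem N (mapEdges (·, w) E + (∑ v ∈ O, mapEdges (v, ·) (pathEdges (w :: a)) +
        ∑ v ∈ Oᶜ, mapEdges (v, ·) (pathEdges (w :: b) + pathEdges (w :: c)))) D' ∧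
      card N = card M + if w ∈ S then Oᶜ.card else 0 := by
  have hM : ∀ l ∈ M, (pathEnds l).Nodup := fun l hl =>
    nodup_of_le (h.ends ▸ le_bind M hl) O.nodup
  by_cases hw : w ∈ S
  · obtain ⟨M', hM', hends, hcard⟩ := h.exists_cut hM Oᶜ
      (fun v hv => Finset.mem_compl.1 hv) fun v _ => hE v
    obtain ⟨N, D', hN, hNcard⟩ := hM'.exists_join hends
      (Oᶜ.val.map (·, b) + Oᶜ.val.map (·, c) + O.val.map (·, a))
      (by simp only [Multiset.map_add, Multiset.map_map, Function.comp_def, map_id'])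
      (by
        intro p hp
        simp only [Multiset.mem_add, mem_map] at hp
        obtain (⟨v, -, rfl⟩ | ⟨v, -, rfl⟩) | ⟨v, -, rfl⟩ := hp
        exacts [hb, hc, ha])
    refine ⟨N, D', ?_, by rw [hNcard, hcard, if_pos hw]⟩
    convert hN using 2
    simp only [add_bind, Multiset.bind_map, _root_.map_add, Finset.sum_add_distrib]
    exact add_comm _ _
  · obtain ⟨rfl, rfl⟩ := hbc hw
    obtain ⟨N, D', hN, hNcard⟩ := h.exists_join hM (O.val.map (·, a))
      (by simp only [Multiset.map_map, Function.comp_def, map_id'])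
      (by
        intro p hp
        obtain ⟨v, -, rfl⟩ := mem_map.1 hp
        exact ha)
    refine ⟨N, D', ?_, by rw [hNcard, if_neg hw, add_zero]⟩
    convert hN using 2
    simp only [Multiset.bind_map, pathEdges_singleton, _root_.map_zero, add_zero,
      Finset.sum_const_zero]
    rfl

theorem two_mul_pathNumber_boxProd_le [Fintype V] [Fintype W] (G : SimpleGraph V)
    (H : SimpleGraph W) [DecidableRel G.Adj] (hG : ∀ v, ∃ u, G.Adj v u)
    (hp : 2 * G.pathNumber = G.oddVertexCount) :
    2 * (G.boxProd H).pathNumber ≤ Fintype.card V * Fintype.card W := by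
  classical
  obtain ⟨M, hM⟩ := exists_isPathSystem_odd hp
  set O := Finset.univ.filter fun v => Odd (G.degree v)
  have hE (v : V) : ∃ e ∈ graphEdges G, v ∈ e :=
    (hG v).imp' (s(v, ·)) fun u hu => ⟨mem_graphEdges.2 hu, Sym2.mem_mk_left v u⟩
  obtain ⟨A, hA⟩ := exists_rooted_paths H
  obtain ⟨S, B, C, F, EB, EC, EF, DF, hB, hC, hF, hBCF, hS, hBC⟩ := exists_rooted_pairs H
  choose N D hN hNcard using fun w =>
    hM.exists_layer hE (hA.nodup w) (hB.nodup w) (hC.nodup w) (hBC w)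
  choose DF' hF' using fun v : V => hF.exists_map (Prod.mk_right_injective v)
  have hsystem := (IsPathSystem.sum fun w (_ : w ∈ Finset.univ) => hN w).add
    (IsPathSystem.sum fun v (_ : v ∈ Oᶜ) => hF' v)
  rw [sum_layers_add G O hA hB hC hBCF] at hsystem
  calc 2 * (G.boxProd H).pathNumber
      ≤ 2 * card (∑ w, N w + ∑ v ∈ Oᶜ, F.map (List.map (v, ·))) := by
        gcongr
        exact hsystem.pathNumber_le
    _ = 2 * (Fintype.card W * card M + Oᶜ.card * (S.card + card F)) := by
        simp only [card_add, card_sum, card_map, hNcard, Finset.sum_const, Finset.sum_add_distrib,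
          Finset.sum_ite_mem, Finset.univ_inter, Finset.card_univ, smul_eq_mul]
        ring
    _ = Fintype.card W * O.card + Oᶜ.card * (2 * (S.card + card F)) := by
        rw [show O.card = 2 * card M from hM.card_ends]
        ring
    _ ≤ Fintype.card W * O.card + Oᶜ.card * Fintype.card W := by gcongr
    _ = Fintype.card V * Fintype.card W := by rw [← O.card_add_card_compl]; ring

end BoxProd

end PathSystem

theorem theorem4p2_general {V W : Type*} [Fintype V] [Fintype W]
    (G : SimpleGraph V) (H : SimpleGraph W) [DecidableRel G.Adj] (hG : ∀ v, ∃ u, G.Adj v u)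
    (hp : (G.pathNumber : ℚ) = (G.oddVertexCount : ℚ) / 2) :
    ((G.boxProd H).pathNumber : ℚ) ≤ (Fintype.card V : ℚ) * (Fintype.card W : ℚ) / 2 ∧
      (G.boxProd H).pathNumber ≤ ⌈(Fintype.card (V × W) : ℚ) / 2⌉₊ := by
  have hle : ((G.boxProd H).pathNumber : ℚ) ≤ (Fintype.card V : ℚ) * (Fintype.card W : ℚ) / 2 := by
    rw [eq_div_iff two_ne_zero, mul_comm] at hp
    rw [le_div_iff₀ two_pos, mul_comm]
    exact_mod_cast PathSystem.two_mul_pathNumber_boxProd_le G H hG (mod_cast hp)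
  refine ⟨hle, Nat.cast_le.1 (hle.trans ?_)⟩
  rw [← Nat.cast_mul, ← Fintype.card_prod]
  exact Nat.le_ceil _

theorem theorem4p2 {V W : Type*} [Fintype V] [Fintype W]
    (G : SimpleGraph V) (H : SimpleGraph W) [DecidableRel G.Adj]
    (hG : G.Connected) (hm : 2 ≤ Fintype.card V)
    (hp : (G.pathNumber : ℚ) = (G.oddVertexCount : ℚ) / 2)
    (hH : H.Connected) :
    ((G.boxProd H).pathNumber : ℚ) ≤ (Fintype.card V : ℚ) * (Fintype.card W : ℚ) / 2 ∧
      ((G.boxProd H).Connected ∧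
        (G.boxProd H).pathNumber ≤ ⌈(Fintype.card (V × W) : ℚ) / 2⌉₊) := by
  have : Nontrivial V := Fintype.one_lt_card_iff_nontrivial.1 hm
  exact (theorem4p2_general G H hG.preconnected.exists_adj_of_nontrivial hp).imp_right
    fun hceil => ⟨hG.boxProd hH, hceil⟩
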